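/- Let $p\ge 0$ and let $X,Y$ be random vectors in $\mathbb R^p$ that are jointly Gaussian, $$\begin{pmatrix}X\\Y\end{pmatrix}\sim\mathcal N_{2p}\left(\begin{pmatrix}\mu_X\\ \mu_Y\end{pmatrix},\begin{pmatrix}\Sigma_{11}&\Sigma_{12}\\ \Sigma_{21}&\Sigma_{22}\end{pmatrix}\right),$$ where the joint covariance matrix is nonnegative definite (possibly singular), $\Sigma_{11}$ has rank $k\le p$, and $\mu_Y=-\mu_X$. Let $A$ be a symmetric nonnegative definite $p\times p$ matrix with $A\Sigma_{11}A=A$, $\Sigma_{11}A\Sigma_{11}=\Sigma_{11}$ and $\Sigma_{11}A\mu_X=\mu_X$, and let $W=A^{1/2}W^*A^{1/2}$, where $W^*$ is a symmetric nonnegative definite $p\times p$ matrix. Write $\chi^2_n(\Delta)$ for a noncentral chi-square variable with $n$ degrees of freedom and noncentrality parameter $\Delta$, i.e. one distributed as $(Z_1+\sqrt\Delta)^2+Z_2^2+\dots+Z_n^2$ with $Z_1,\dots,Z_n$ independent standard normal, and put $\Delta=\mu_X'A\mu_X$. Let $h:\mathbb R\to\mathbb R$ be Borel measurable with $\mathrm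 E|h(\chi^2_{k+2}(\Delta))|<\infty$ and $\mathrm E|h(\chi^2_{k+4}(\Delta))|<\infty$. If $\mathrm E|h(X'AX)|<\infty$, then $\mathrm E|h(X'AX)\,Y'WX|<\infty$. Moreover, whenever $\mathrm E|h(X'AX)\,Y'WX|<\infty$ (in particular whenever $\mathrm E|h(X'AX)|<\infty$), $$\begin{aligned}\mathrm E[h(X'AX)\,Y'WX]={}&-\mathrm E[h(\chi^2_{k+2}(\Delta))]\,\mu_X'W\mu_X-\mathrm E[h(\chi^2_{k+2}(\Delta))]\,\mu_X'A\Sigma_{12}W\mu_X\\&+\mathrm E[h(\chi^2_{k+2}(\Delta))]\,\mathrm{tr}(\Sigma_{12}W\Sigma_{11}A)+\mathrm E[h(\chi^2_{k+4}(\Delta))]\,\mu_X'A\Sigma_{12}W\mu_X.\end{aligned}$$ -/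

import Mathlib

open MeasureTheory ProbabilityTheory Matrix
open scoped MatrixOrder

/-- The noncentral chi-square distribution `χ²_n(Δ)` with `n ≥ 1` degrees of freedom and
noncentrality parameter `Δ ≥ 0`: the law of `(Z₁ + √Δ)² + Z₂² + ⋯ + Zₙ²`, where `Z₁, …, Zₙ` are
independent standard normal variables. -/
noncomputable def noncentralChiSq (n : ℕ) [NeZero n] (Δ : ℝ) : Measure ℝ :=
  (Measure.pi fun i : Fin n => gaussianReal ((Pi.single 0 (√Δ) : Fin n → ℝ) i) 1).map
    fun z => ∑ i, z i ^ 2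

/-! Factor `S11 = L * Lᵀ` with `k` independent columns. The hypotheses on `A` give `Lᵀ * A * L = 1`,
so `X = L z` with `z ~ N(ν, I_k)`, `X'AX = |z|²` and `Δ = |ν|²`. Regressing on `z` gives `Y = μY + C
(z - ν) + K w` with `w` standard normal and independent of `z`. Thus `Y'WX` is a linear plus a
quadratic form in `z`, plus a term linear in `w` that averages to zero.

It remains to weight the law of `|z|²` by `c ⬝ᵥ z` and by `(c ⬝ᵥ z) ^ 2`. Tilting by `exp(-t|z|²)`
turns `N(ν, I)` into `b ^ k * exp(-tΔb²)` times `N(b²ν, b²I)`, where `b² = 1 / (1 + 2t)`. The two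
weights then have means `b² (c ⬝ᵥ ν)` and `b² |c|² + b⁴ (c ⬝ᵥ ν) ^ 2`, and each `b²` adds two
degrees of freedom to the chi-square Laplace transform. Uniqueness of Laplace transforms makes these
identities of measures (`map_withDensity_dotProduct`, `map_withDensity_sq_dotProduct`), valid for
every admissible `h`. -/

/-! ### Uniqueness of moments and Laplace transforms -/

open Complex in
/-- Hausdorff moment uniqueness: finite measures on the unit interval are determined by their
moments. -/
lemma ext_of_integral_pow_eq {ρ₁ ρ₂ : Measure ℝ} [IsFiniteMeasure ρ₁] [IsFiniteMeasure ρ₂]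
    (h₁ : ∀ᵐ x ∂ρ₁, |x| ≤ 1) (h₂ : ∀ᵐ x ∂ρ₂, |x| ≤ 1)
    (h : ∀ n : ℕ, ∫ x, x ^ n ∂ρ₁ = ∫ x, x ^ n ∂ρ₂) : ρ₁ = ρ₂ := by
  -- The characteristic function is a power series in the moments; the bound `|s| ^ n / n!`
  -- justifies integrating termwise.
  have key (ρ : Measure ℝ) [IsFiniteMeasure ρ] (hρ : ∀ᵐ x ∂ρ, |x| ≤ 1) (s : ℝ) :
      charFun ρ s = ∑' n : ℕ, (s * I) ^ n / (n.factorial : ℂ) * ((∫ x, x ^ n ∂ρ : ℝ) : ℂ) := by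
    have hint (n : ℕ) : Integrable (fun x : ℝ => ((x : ℂ)) ^ n) ρ := by
      refine Integrable.of_bound (by fun_prop) 1 ?_
      filter_upwards [hρ] with x hx
      simpa using pow_le_one₀ (abs_nonneg x) hx
    have := hasSum_integral_of_summable_integral_norm (μ := ρ)
      (F := fun (n : ℕ) (x : ℝ) => (s * I) ^ n / (n.factorial : ℂ) * (x : ℂ) ^ n)
      (fun n => (hint n).const_mul _) ?_
    · rw [charFun_apply_real]
      rw [integral_congr_ae (g := fun x : ℝ =>
        ∑' n : ℕ, (s * I) ^ n / (n.factorial : ℂ) * (x : ℂ) ^ n), ← this.tsum_eq]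
      · congr with n
        rw [integral_const_mul, ← integral_complex_ofReal]
        simp
      · refine .of_forall fun x => ?_
        simp only [Complex.exp_eq_exp_ℂ, NormedSpace.exp_eq_tsum_div]
        congr with n
        ring
    · refine Summable.of_nonneg_of_le (fun n => by positivity) (fun n => ?_)
        ((Real.summable_pow_div_factorial |s|).mul_right (ρ.real Set.univ))
      calc _ ≤ ∫ _x, |s| ^ n / n.factorial ∂ρ := by
            refine integral_mono_ae ((hint n).const_mul _).norm (integrable_const _) ?_
            filter_upwards [hρ] with x hx
            simp only [norm_mul, norm_div, norm_pow, norm_real, Real.norm_eq_abs, norm_I, mul_one,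
              Complex.norm_natCast]
            exact mul_le_of_le_one_right (by positivity) (pow_le_one₀ (abs_nonneg x) hx)
        _ = _ := by simp [mul_comm]
  refine Measure.ext_of_charFun (funext fun s => ?_)
  rw [key ρ₁ h₁, key ρ₂ h₂]
  simp_rw [h]

/-- Finite measures on the half-line are determined by their Laplace transforms. -/
lemma ext_of_integral_exp_neg_eq {ρ₁ ρ₂ : Measure ℝ} [IsFiniteMeasure ρ₁] [IsFiniteMeasure ρ₂]
    (h₁ : ∀ᵐ x ∂ρ₁, 0 ≤ x) (h₂ : ∀ᵐ x ∂ρ₂, 0 ≤ x)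
    (h : ∀ t : ℝ, 0 ≤ t → ∫ x, Real.exp (-t * x) ∂ρ₁ = ∫ x, Real.exp (-t * x) ∂ρ₂) :
    ρ₁ = ρ₂ := by
  have hm : Measurable fun x : ℝ => Real.exp (-x) := by fun_prop
  have hl : Measurable fun x : ℝ => -Real.log x := by fun_prop
  -- Under `x ↦ exp (-x)` the half-line lands in the unit interval, and the `n`-th moment of the
  -- image is the Laplace transform at `t = n`.
  have key : ρ₁.map (fun x => Real.exp (-x)) = ρ₂.map (fun x => Real.exp (-x)) := by
    have hs : MeasurableSet {x : ℝ | |x| ≤ 1} := measurableSet_le (by fun_prop) (by fun_prop)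
    refine ext_of_integral_pow_eq ?_ ?_ fun n => ?_
    · rw [ae_map_iff hm.aemeasurable hs]
      filter_upwards [h₁] with x hx
      simpa [abs_of_pos (Real.exp_pos _)] using hx
    · rw [ae_map_iff hm.aemeasurable hs]
      filter_upwards [h₂] with x hx
      simpa [abs_of_pos (Real.exp_pos _)] using hx
    · rw [integral_map hm.aemeasurable (by fun_prop), integral_map hm.aemeasurable (by fun_prop)]
      simpa [← Real.exp_nat_mul] using h n n.cast_nonneg
  have := congrArg (Measure.map fun x : ℝ => -Real.log x) key
  rw [Measure.map_map hl hm, Measure.map_map hl hm] at this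
  simpa [Function.comp_def] using this

/-! ### Gaussian tilting -/

/-- Exponential tilting of a Gaussian measure by a square. -/
lemma gaussianReal_withDensity_exp_neg_sq (m : ℝ) {t : ℝ} (ht : 0 ≤ t) :
    (gaussianReal m 1).withDensity (fun z => ENNReal.ofReal (Real.exp (-t * z ^ 2))) =
      ENNReal.ofReal (√(1 / (1 + 2 * t)) * Real.exp (-t * m ^ 2 / (1 + 2 * t))) •
        gaussianReal (m / (1 + 2 * t)) (1 / (1 + 2 * t)).toNNReal := by
  have hpos : 0 < 1 + 2 * t := by positivity
  have hv : (1 / (1 + 2 * t)).toNNReal ≠ 0 := by simpa using hpos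
  rw [gaussianReal_of_var_ne_zero _ one_ne_zero, gaussianReal_of_var_ne_zero _ hv,
    ← withDensity_smul _ (measurable_gaussianPDF _ _),
    ← withDensity_mul _ (measurable_gaussianPDF _ _) (by fun_prop)]
  refine congrArg _ (funext fun z => ?_)
  simp only [Pi.mul_apply, Pi.smul_apply, smul_eq_mul, gaussianPDF]
  rw [← ENNReal.ofReal_mul (gaussianPDFReal_nonneg _ _ _), ← ENNReal.ofReal_mul (by positivity)]
  congr 1
  simp only [gaussianPDFReal, NNReal.coe_one, mul_one]
  rw [Real.coe_toNNReal _ (by positivity), Real.sqrt_mul (by positivity) (1 / (1 + 2 * t)), mul_inv]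
  have hs : √(1 / (1 + 2 * t)) ≠ 0 := by positivity
  -- Completing the square in `z`.
  have he : Real.exp (-(z - m) ^ 2 / 2) * Real.exp (-t * z ^ 2) =
      Real.exp (-t * m ^ 2 / (1 + 2 * t)) *
        Real.exp (-(z - m / (1 + 2 * t)) ^ 2 / (2 * (1 / (1 + 2 * t)))) := by
    rw [← Real.exp_add, ← Real.exp_add]
    congr 1
    field_simp
    ring
  rw [mul_assoc, he]
  field_simp

lemma pi_withDensity_ofReal {ι : Type*} [Fintype ι] {α : ι → Type*} [∀ i, MeasurableSpace (α i)]
    (μ : ∀ i, Measure (α i)) [∀ i, IsFiniteMeasure (μ i)] {f : ∀ i, α i → ℝ}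
    (hf : ∀ i, Integrable (f i) (μ i)) (hf0 : ∀ i x, 0 ≤ f i x) :
    Measure.pi (fun i => (μ i).withDensity fun x => ENNReal.ofReal (f i x)) =
      (Measure.pi μ).withDensity fun x => ENNReal.ofReal (∏ i, f i (x i)) := by
  have (i : ι) := isFiniteMeasure_withDensity_ofReal (hf i).2
  refine Measure.pi_eq fun s hs => ?_
  rw [withDensity_apply _ (.univ_pi hs), Measure.restrict_pi_pi,
    ← ofReal_integral_eq_lintegral_ofReal, integral_fintype_prod_eq_prod,
    ENNReal.ofReal_prod_of_nonneg fun i _ => integral_nonneg (hf0 i)]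
  · refine Finset.prod_congr rfl fun i _ => ?_
    rw [withDensity_apply _ (hs i), ofReal_integral_eq_lintegral_ofReal (hf i).restrict
      (.of_forall (hf0 i))]
  · exact Integrable.fintype_prod_dep fun i => (hf i).restrict
  · exact .of_forall fun x => Finset.prod_nonneg fun i _ => hf0 i _

lemma pi_smul_measure {ι : Type*} [Fintype ι] {α : ι → Type*} [∀ i, MeasurableSpace (α i)]
    (μ : ∀ i, Measure (α i)) [∀ i, IsFiniteMeasure (μ i)] {a : ι → ℝ} (ha : ∀ i, 0 ≤ a i) :
    Measure.pi (fun i => ENNReal.ofReal (a i) • μ i) =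
      ENNReal.ofReal (∏ i, a i) • Measure.pi μ := by
  have (i : ι) : IsFiniteMeasure (ENNReal.ofReal (a i) • μ i) :=
    Measure.smul_finite _ ENNReal.ofReal_ne_top
  refine Measure.pi_eq fun s hs => ?_
  simp [Measure.pi_pi, Finset.prod_mul_distrib, ENNReal.ofReal_prod_of_nonneg fun i _ => ha i]

/-- The tilt factors over coordinates. `F` is unrestricted because the identity holds between
measures. -/
lemma integral_pi_gaussianReal_mul_exp_neg_sq {ι : Type*} [Fintype ι] (ν : ι → ℝ) {t : ℝ}
    (ht : 0 ≤ t) (F : (ι → ℝ) → ℝ) :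
    ∫ z, Real.exp (-t * (z ⬝ᵥ z)) * F z ∂(Measure.pi fun i => gaussianReal (ν i) 1) =
      √(1 / (1 + 2 * t)) ^ Fintype.card ι * Real.exp (-t * (ν ⬝ᵥ ν) / (1 + 2 * t)) *
        ∫ z, F z ∂(Measure.pi fun i =>
          gaussianReal (ν i / (1 + 2 * t)) (1 / (1 + 2 * t)).toNNReal) := by
  have hexp (z : ι → ℝ) : Real.exp (-t * (z ⬝ᵥ z)) = ∏ i, Real.exp (-t * z i ^ 2) := by
    simp [← Real.exp_sum, dotProduct, Finset.mul_sum, pow_two]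
  have hb (m : ℝ) : Integrable (fun z => Real.exp (-t * z ^ 2)) (gaussianReal m 1) := by
    refine Integrable.of_bound (by fun_prop) 1 (.of_forall fun z => ?_)
    rw [Real.norm_eq_abs, Real.abs_exp, Real.exp_le_one_iff]
    nlinarith [mul_nonneg ht (sq_nonneg z)]
  have h1 := pi_withDensity_ofReal (fun i => gaussianReal (ν i) 1)
    (f := fun _ z => Real.exp (-t * z ^ 2)) (fun i => hb _) (fun _ _ => by positivity)
  simp_rw [gaussianReal_withDensity_exp_neg_sq _ ht] at h1
  rw [pi_smul_measure _ (fun i => by positivity)] at h1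
  have h2 := congrArg (fun m => ∫ z, F z ∂m) h1
  rw [integral_smul_measure, integral_withDensity_eq_integral_toReal_smul (by fun_prop)
    (.of_forall fun _ => ENNReal.ofReal_lt_top)] at h2
  rw [ENNReal.toReal_ofReal (Finset.prod_nonneg fun _ _ => by positivity)] at h2
  simp_rw [hexp]
  rw [Finset.prod_mul_distrib, ← Real.exp_sum] at h2
  convert h2.symm using 1
  · congr with z
    rw [ENNReal.toReal_ofReal (Finset.prod_nonneg fun _ _ => by positivity), smul_eq_mul]
  · simp [dotProduct, Finset.mul_sum, ← Finset.sum_div, pow_two]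

/-! ### Laws weighted by a density -/

section WeightedLaw

variable {α : Type*} [MeasurableSpace α] {μ : Measure α} {T g : α → ℝ} {h : ℝ → ℝ}

/-- `ENNReal.ofReal` cuts `g` off at zero, so a signed weight must be treated through its positive
and negative parts. -/
lemma integrable_map_withDensity_iff (hT : Measurable T) (hg : Measurable g) (hh : Measurable h) :
    Integrable h ((μ.withDensity fun x => ENNReal.ofReal (g x)).map T) ↔
      Integrable (fun x => h (T x) * max (g x) 0) μ := by
  rw [integrable_map_measure (by fun_prop) (by fun_prop),
    integrable_withDensity_iff (by fun_prop) (.of_forall fun _ => ENNReal.ofReal_lt_top)]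
  simp [ENNReal.toReal_ofReal']

lemma integral_map_withDensity (hT : Measurable T) (hg : Measurable g) (hh : Measurable h) :
    ∫ x, h x ∂((μ.withDensity fun x => ENNReal.ofReal (g x)).map T) =
      ∫ x, h (T x) * max (g x) 0 ∂μ := by
  rw [integral_map (by fun_prop) (by fun_prop),
    integral_withDensity_eq_integral_toReal_smul (by fun_prop)
      (.of_forall fun _ => ENNReal.ofReal_lt_top)]
  simp [ENNReal.toReal_ofReal', mul_comm]

lemma isFiniteMeasure_map_withDensity (hg : Integrable g μ) :
    IsFiniteMeasure ((μ.withDensity fun x => ENNReal.ofReal (g x)).map T) := by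
  have := isFiniteMeasure_withDensity_ofReal hg.2
  infer_instance

end WeightedLaw

lemma integrable_exp_neg_of_nonneg {ρ : Measure ℝ} [IsFiniteMeasure ρ] (hρ : ∀ᵐ x ∂ρ, 0 ≤ x)
    {t : ℝ} (ht : 0 ≤ t) : Integrable (fun x => Real.exp (-t * x)) ρ := by
  refine Integrable.of_bound (by fun_prop) 1 ?_
  filter_upwards [hρ] with x hx
  rw [Real.norm_eq_abs, Real.abs_exp, Real.exp_le_one_iff]
  nlinarith [mul_nonneg ht hx]

/-! ### Laplace transform of the noncentral chi-square law -/

section NoncentralChiSq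

instance isProbabilityMeasure_noncentralChiSq (n : ℕ) [NeZero n] (Δ : ℝ) :
    IsProbabilityMeasure (noncentralChiSq n Δ) :=
  Measure.isProbabilityMeasure_map (Measurable.aemeasurable (by fun_prop))

lemma ae_nonneg_noncentralChiSq (n : ℕ) [NeZero n] (Δ : ℝ) :
    ∀ᵐ x ∂noncentralChiSq n Δ, 0 ≤ x := by
  rw [noncentralChiSq, ae_map_iff (Measurable.aemeasurable (by fun_prop)) measurableSet_Ici]
  exact .of_forall fun z => Finset.sum_nonneg fun i _ => sq_nonneg _

lemma integral_exp_neg_noncentralChiSq (n : ℕ) [NeZero n] {Δ : ℝ} (hΔ : 0 ≤ Δ) {t : ℝ}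
    (ht : 0 ≤ t) :
    ∫ x, Real.exp (-t * x) ∂noncentralChiSq n Δ =
      √(1 / (1 + 2 * t)) ^ n * Real.exp (-t * Δ / (1 + 2 * t)) := by
  rw [noncentralChiSq, integral_map (Measurable.aemeasurable (by fun_prop)) (by fun_prop)]
  have := integral_pi_gaussianReal_mul_exp_neg_sq (Pi.single 0 (√Δ) : Fin n → ℝ) ht fun _ => 1
  simpa [dotProduct, ← pow_two, Pi.single_apply, ite_pow, Real.sq_sqrt hΔ] using this

end NoncentralChiSq

/-! ### Radial functions times polynomials of a Gaussian vector -/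

section GaussianVector

variable {κ : Type*} [Fintype κ]

lemma memLp_dotProduct_pi_gaussianReal (m : κ → ℝ) (v : NNReal) (c : κ → ℝ) :
    MemLp (fun z => c ⬝ᵥ z) 2 (Measure.pi fun i => gaussianReal (m i) v) := by
  unfold dotProduct
  refine memLp_finsetSum _ fun i _ => MemLp.const_mul ?_ _
  exact (memLp_id_gaussianReal 2).comp_measurePreserving
    (measurePreserving_eval (fun i => gaussianReal (m i) v) i)

lemma integral_dotProduct_pi_gaussianReal (m : κ → ℝ) (v : NNReal) (c : κ → ℝ) :
    ∫ z, c ⬝ᵥ z ∂(Measure.pi fun i => gaussianReal (m i) v) = c ⬝ᵥ m := by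
  unfold dotProduct
  rw [integral_finsetSum _ fun i _ =>
    (integrable_eval (IsGaussian.integrable_id (μ := gaussianReal (m i) v))).const_mul (c i)]
  simp [integral_const_mul, integral_eval]

lemma integral_sq_dotProduct_pi_gaussianReal (m : κ → ℝ) (v : NNReal) (c : κ → ℝ) :
    ∫ z, (c ⬝ᵥ z) ^ 2 ∂(Measure.pi fun i => gaussianReal (m i) v) =
      v * (c ⬝ᵥ c) + (c ⬝ᵥ m) ^ 2 := by
  have hvar := variance_eq_sub (memLp_dotProduct_pi_gaussianReal m v c)
  rw [integral_dotProduct_pi_gaussianReal] at hvar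
  have hsum : (fun z : κ → ℝ => c ⬝ᵥ z) = ∑ i, fun z : κ → ℝ => c i * z i := by
    ext z; simp [dotProduct]
  have hvar' : Var[fun z => c ⬝ᵥ z; Measure.pi fun i => gaussianReal (m i) v] = v * (c ⬝ᵥ c) := by
    rw [hsum, variance_sum_pi (X := fun i z => c i * z)
      fun i => (memLp_id_gaussianReal 2).const_mul (c i)]
    simp only [dotProduct, Finset.mul_sum]
    refine Finset.sum_congr rfl fun i _ => ?_
    rw [variance_const_mul, variance_fun_id_gaussianReal]
    ring
  rw [hvar'] at hvar
  simp only [Pi.pow_apply] at hvar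
  linarith

/-- Laplace transforms agree: the tilted second moment is `b² |c|² + b⁴ (c ⬝ᵥ ν) ^ 2`, and each `b²`
raises the degrees of freedom by two. -/
lemma map_withDensity_sq_dotProduct (ν c : κ → ℝ) :
    ((Measure.pi fun i => gaussianReal (ν i) 1).withDensity
        fun z => ENNReal.ofReal ((c ⬝ᵥ z) ^ 2)).map (fun z => z ⬝ᵥ z) =
      ENNReal.ofReal (c ⬝ᵥ c) • noncentralChiSq (Fintype.card κ + 2) (ν ⬝ᵥ ν) +
      ENNReal.ofReal ((c ⬝ᵥ ν) ^ 2) • noncentralChiSq (Fintype.card κ + 4) (ν ⬝ᵥ ν) := by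
  have hT : Measurable fun z : κ → ℝ => z ⬝ᵥ z := by unfold dotProduct; fun_prop
  have hg : Measurable fun z : κ → ℝ => (c ⬝ᵥ z) ^ 2 := by unfold dotProduct; fun_prop
  have hΔ : 0 ≤ ν ⬝ᵥ ν := by simpa using dotProduct_star_self_nonneg ν
  have hc : 0 ≤ c ⬝ᵥ c := by simpa using dotProduct_star_self_nonneg c
  have : IsFiniteMeasure (((Measure.pi fun i => gaussianReal (ν i) 1).withDensity
        fun z => ENNReal.ofReal ((c ⬝ᵥ z) ^ 2)).map (fun z => z ⬝ᵥ z)) :=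
    isFiniteMeasure_map_withDensity (memLp_dotProduct_pi_gaussianReal ν 1 c).integrable_sq
  have (n : ℕ) [NeZero n] (x : ℝ) :
      IsFiniteMeasure (ENNReal.ofReal x • noncentralChiSq n (ν ⬝ᵥ ν)) :=
    Measure.smul_finite _ ENNReal.ofReal_ne_top
  have hp (n : ℕ) [NeZero n] (x : ℝ) :
      ∀ᵐ y ∂(ENNReal.ofReal x • noncentralChiSq n (ν ⬝ᵥ ν)), 0 ≤ y :=
    Measure.ae_smul_measure (ae_nonneg_noncentralChiSq n _) _
  refine ext_of_integral_exp_neg_eq ?_ ?_ fun t ht => ?_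
  · rw [ae_map_iff hT.aemeasurable measurableSet_Ici]
    exact .of_forall fun z => by simpa using dotProduct_star_self_nonneg z
  · exact ae_add_measure_iff.2 ⟨hp _ _, hp _ _⟩
  · rw [integral_map_withDensity hT hg (by fun_prop),
      integral_add_measure (integrable_exp_neg_of_nonneg (hp _ _) ht)
        (integrable_exp_neg_of_nonneg (hp _ _) ht), integral_smul_measure, integral_smul_measure,
      integral_exp_neg_noncentralChiSq _ hΔ ht, integral_exp_neg_noncentralChiSq _ hΔ ht,
      ENNReal.toReal_ofReal hc, ENNReal.toReal_ofReal (sq_nonneg _)]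
    simp_rw [max_eq_left (sq_nonneg _)]
    rw [integral_pi_gaussianReal_mul_exp_neg_sq ν ht, integral_sq_dotProduct_pi_gaussianReal,
      Real.coe_toNNReal _ (by positivity)]
    have hb : 1 / (1 + 2 * t) = √(1 / (1 + 2 * t)) ^ 2 := (Real.sq_sqrt (by positivity)).symm
    have hm : c ⬝ᵥ (fun i => ν i / (1 + 2 * t)) = 1 / (1 + 2 * t) * (c ⬝ᵥ ν) := by
      simp only [dotProduct, Finset.mul_sum]
      exact Finset.sum_congr rfl fun i _ => by ring
    rw [hm]
    set b := √(1 / (1 + 2 * t))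
    rw [hb]
    simp only [smul_eq_mul]
    ring

/-- The signed weight is split, with the negative part moved to the right, so that both sides are
positive measures; `hcν` keeps the chi-square coefficient nonnegative. -/
lemma map_withDensity_dotProduct (ν c : κ → ℝ) (hcν : 0 ≤ c ⬝ᵥ ν) :
    ((Measure.pi fun i => gaussianReal (ν i) 1).withDensity
        fun z => ENNReal.ofReal (c ⬝ᵥ z)).map (fun z => z ⬝ᵥ z) =
      ENNReal.ofReal (c ⬝ᵥ ν) • noncentralChiSq (Fintype.card κ + 2) (ν ⬝ᵥ ν) +
      ((Measure.pi fun i => gaussianReal (ν i) 1).withDensity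
        fun z => ENNReal.ofReal (-(c ⬝ᵥ z))).map (fun z => z ⬝ᵥ z) := by
  have hT : Measurable fun z : κ → ℝ => z ⬝ᵥ z := by unfold dotProduct; fun_prop
  have hg : Measurable fun z : κ → ℝ => c ⬝ᵥ z := by unfold dotProduct; fun_prop
  have hg' : Measurable fun z : κ → ℝ => -(c ⬝ᵥ z) := hg.neg
  have hΔ : 0 ≤ ν ⬝ᵥ ν := by simpa using dotProduct_star_self_nonneg ν
  have hi : Integrable (fun z => c ⬝ᵥ z) (Measure.pi fun i => gaussianReal (ν i) 1) :=
    (memLp_dotProduct_pi_gaussianReal ν 1 c).integrable (by norm_num)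
  have : IsFiniteMeasure (((Measure.pi fun i => gaussianReal (ν i) 1).withDensity
        fun z => ENNReal.ofReal (c ⬝ᵥ z)).map (fun z => z ⬝ᵥ z)) :=
    isFiniteMeasure_map_withDensity hi
  have : IsFiniteMeasure (((Measure.pi fun i => gaussianReal (ν i) 1).withDensity
        fun z => ENNReal.ofReal (-(c ⬝ᵥ z))).map (fun z => z ⬝ᵥ z)) :=
    isFiniteMeasure_map_withDensity hi.neg
  have : IsFiniteMeasure (ENNReal.ofReal (c ⬝ᵥ ν) •
      noncentralChiSq (Fintype.card κ + 2) (ν ⬝ᵥ ν)) :=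
    Measure.smul_finite _ ENNReal.ofReal_ne_top
  have hp : ∀ᵐ y ∂(ENNReal.ofReal (c ⬝ᵥ ν) •
      noncentralChiSq (Fintype.card κ + 2) (ν ⬝ᵥ ν)), 0 ≤ y :=
    Measure.ae_smul_measure (ae_nonneg_noncentralChiSq _ _) _
  have hq (g : (κ → ℝ) → ℝ) : ∀ᵐ y ∂(((Measure.pi fun i => gaussianReal (ν i) 1).withDensity
        fun z => ENNReal.ofReal (g z)).map (fun z => z ⬝ᵥ z)), 0 ≤ y := by
    rw [ae_map_iff hT.aemeasurable measurableSet_Ici]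
    exact .of_forall fun z => by simpa using dotProduct_star_self_nonneg z
  refine ext_of_integral_exp_neg_eq (hq _) (ae_add_measure_iff.2 ⟨hp, hq _⟩) fun t ht => ?_
  have hi1 := (integrable_map_withDensity_iff hT hg (by fun_prop)).1
    (integrable_exp_neg_of_nonneg (hq fun z => c ⬝ᵥ z) ht)
  have hi2 := (integrable_map_withDensity_iff hT hg' (by fun_prop)).1
    (integrable_exp_neg_of_nonneg (hq fun z => -(c ⬝ᵥ z)) ht)
  rw [integral_add_measure (integrable_exp_neg_of_nonneg hp ht)
      (integrable_exp_neg_of_nonneg (hq _) ht), integral_smul_measure,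
    integral_map_withDensity hT hg (by fun_prop), integral_map_withDensity hT hg' (by fun_prop),
    integral_exp_neg_noncentralChiSq _ hΔ ht, ENNReal.toReal_ofReal hcν, ← sub_eq_iff_eq_add,
    ← integral_sub hi1 hi2]
  simp_rw [← mul_sub, max_zero_sub_max_neg_zero_eq_self]
  rw [integral_pi_gaussianReal_mul_exp_neg_sq ν ht, integral_dotProduct_pi_gaussianReal]
  have hb : 1 / (1 + 2 * t) = √(1 / (1 + 2 * t)) ^ 2 := (Real.sq_sqrt (by positivity)).symm
  have hm : c ⬝ᵥ (fun i => ν i / (1 + 2 * t)) = 1 / (1 + 2 * t) * (c ⬝ᵥ ν) := by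
    simp only [dotProduct, Finset.mul_sum]
    exact Finset.sum_congr rfl fun i _ => by ring
  rw [hm]
  set b := √(1 / (1 + 2 * t))
  rw [hb]
  simp only [smul_eq_mul]
  ring

variable {ν : κ → ℝ} {h : ℝ → ℝ}

lemma integrable_radial_mul_sq_dotProduct (hh : Measurable h)
    (h2 : Integrable h (noncentralChiSq (Fintype.card κ + 2) (ν ⬝ᵥ ν)))
    (h4 : Integrable h (noncentralChiSq (Fintype.card κ + 4) (ν ⬝ᵥ ν))) (c : κ → ℝ) :
    Integrable (fun z => h (z ⬝ᵥ z) * (c ⬝ᵥ z) ^ 2) (Measure.pi fun i => gaussianReal (ν i) 1) := by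
  have hT : Measurable fun z : κ → ℝ => z ⬝ᵥ z := by unfold dotProduct; fun_prop
  have hg : Measurable fun z : κ → ℝ => (c ⬝ᵥ z) ^ 2 := by unfold dotProduct; fun_prop
  have := (integrable_map_withDensity_iff hT hg hh (μ := Measure.pi fun i => gaussianReal (ν i) 1)).1
    (by
      rw [map_withDensity_sq_dotProduct]
      exact (h2.smul_measure ENNReal.ofReal_ne_top).add_measure
        (h4.smul_measure ENNReal.ofReal_ne_top))
  simpa only [max_eq_left (sq_nonneg _)] using this

lemma integral_radial_mul_sq_dotProduct (hh : Measurable h)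
    (h2 : Integrable h (noncentralChiSq (Fintype.card κ + 2) (ν ⬝ᵥ ν)))
    (h4 : Integrable h (noncentralChiSq (Fintype.card κ + 4) (ν ⬝ᵥ ν))) (c : κ → ℝ) :
    ∫ z, h (z ⬝ᵥ z) * (c ⬝ᵥ z) ^ 2 ∂(Measure.pi fun i => gaussianReal (ν i) 1) =
      (∫ x, h x ∂noncentralChiSq (Fintype.card κ + 2) (ν ⬝ᵥ ν)) * (c ⬝ᵥ c) +
      (∫ x, h x ∂noncentralChiSq (Fintype.card κ + 4) (ν ⬝ᵥ ν)) * (c ⬝ᵥ ν) ^ 2 := by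
  have hT : Measurable fun z : κ → ℝ => z ⬝ᵥ z := by unfold dotProduct; fun_prop
  have hg : Measurable fun z : κ → ℝ => (c ⬝ᵥ z) ^ 2 := by unfold dotProduct; fun_prop
  have hc : 0 ≤ c ⬝ᵥ c := by simpa using dotProduct_star_self_nonneg c
  have := integral_map_withDensity hT hg hh (μ := Measure.pi fun i => gaussianReal (ν i) 1)
  simp only [max_eq_left (sq_nonneg _)] at this
  rw [← this, map_withDensity_sq_dotProduct,
    integral_add_measure (h2.smul_measure ENNReal.ofReal_ne_top)
      (h4.smul_measure ENNReal.ofReal_ne_top), integral_smul_measure, integral_smul_measure,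
    ENNReal.toReal_ofReal hc, ENNReal.toReal_ofReal (sq_nonneg _), smul_eq_mul, smul_eq_mul]
  ring

/-- `h2` controls only the difference of the two half-weighted laws, hence the separate hypothesis
`hc`. -/
lemma integral_radial_mul_dotProduct (hh : Measurable h)
    (h2 : Integrable h (noncentralChiSq (Fintype.card κ + 2) (ν ⬝ᵥ ν))) (c : κ → ℝ)
    (hc : Integrable (fun z => h (z ⬝ᵥ z) * (c ⬝ᵥ z)) (Measure.pi fun i => gaussianReal (ν i) 1)) :
    ∫ z, h (z ⬝ᵥ z) * (c ⬝ᵥ z) ∂(Measure.pi fun i => gaussianReal (ν i) 1) =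
      (∫ x, h x ∂noncentralChiSq (Fintype.card κ + 2) (ν ⬝ᵥ ν)) * (c ⬝ᵥ ν) := by
  wlog hcν : 0 ≤ c ⬝ᵥ ν generalizing c
  · have := this (-c) (by simpa using hc.neg) (by simpa using (not_le.1 hcν).le)
    simpa [integral_neg] using this
  have hT : Measurable fun z : κ → ℝ => z ⬝ᵥ z := by unfold dotProduct; fun_prop
  have hg : Measurable fun z : κ → ℝ => c ⬝ᵥ z := by unfold dotProduct; fun_prop
  have hg' : Measurable fun z : κ → ℝ => -(c ⬝ᵥ z) := hg.neg
  have hpart (s : (κ → ℝ) → ℝ) (hs : Measurable s) (hle : ∀ z, |s z| ≤ |c ⬝ᵥ z|) :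
      Integrable (fun z => h (z ⬝ᵥ z) * s z) (Measure.pi fun i => gaussianReal (ν i) 1) := by
    refine hc.mono (by fun_prop) (.of_forall fun z => ?_)
    simp only [norm_mul, Real.norm_eq_abs]
    exact mul_le_mul_of_nonneg_left (hle z) (abs_nonneg _)
  have hi1 := hpart (fun z => max (c ⬝ᵥ z) 0) (by fun_prop) fun z => by
    rw [abs_of_nonneg (le_max_right _ _)]; exact max_le (le_abs_self _) (abs_nonneg _)
  have hi2 := hpart (fun z => max (-(c ⬝ᵥ z)) 0) (by fun_prop) fun z => by
    rw [abs_of_nonneg (le_max_right _ _)]; exact max_le (neg_le_abs _) (abs_nonneg _)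
  have key := congrArg (fun ρ => ∫ x, h x ∂ρ) (map_withDensity_dotProduct ν c hcν)
  rw [integral_add_measure (h2.smul_measure ENNReal.ofReal_ne_top)
      ((integrable_map_withDensity_iff hT hg' hh).2 hi2), integral_smul_measure,
    integral_map_withDensity hT hg hh, integral_map_withDensity hT hg' hh,
    ENNReal.toReal_ofReal hcν, ← sub_eq_iff_eq_add, ← integral_sub hi1 hi2, smul_eq_mul] at key
  simp_rw [← mul_sub, max_zero_sub_max_neg_zero_eq_self] at key
  rw [key, mul_comm]

/-- Polarization, reducing products of linear forms to squares. -/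
lemma dotProduct_mul_dotProduct_eq (c d z : κ → ℝ) :
    (c ⬝ᵥ z) * (d ⬝ᵥ z) =
      1 / 2 * (((c + d) ⬝ᵥ z) ^ 2 - (c ⬝ᵥ z) ^ 2 - (d ⬝ᵥ z) ^ 2) := by
  simp only [add_dotProduct]; ring

lemma integrable_radial_mul_dotProduct_mul (hh : Measurable h)
    (h2 : Integrable h (noncentralChiSq (Fintype.card κ + 2) (ν ⬝ᵥ ν)))
    (h4 : Integrable h (noncentralChiSq (Fintype.card κ + 4) (ν ⬝ᵥ ν))) (c d : κ → ℝ) :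
    Integrable (fun z => h (z ⬝ᵥ z) * ((c ⬝ᵥ z) * (d ⬝ᵥ z)))
      (Measure.pi fun i => gaussianReal (ν i) 1) := by
  have := (((integrable_radial_mul_sq_dotProduct hh h2 h4 (c + d)).sub
    (integrable_radial_mul_sq_dotProduct hh h2 h4 c)).sub
    (integrable_radial_mul_sq_dotProduct hh h2 h4 d)).const_mul (1 / 2)
  refine this.congr (.of_forall fun z => ?_)
  simp only [dotProduct_mul_dotProduct_eq c d, Pi.sub_apply]
  ring

lemma integral_radial_mul_dotProduct_mul (hh : Measurable h)
    (h2 : Integrable h (noncentralChiSq (Fintype.card κ + 2) (ν ⬝ᵥ ν)))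
    (h4 : Integrable h (noncentralChiSq (Fintype.card κ + 4) (ν ⬝ᵥ ν))) (c d : κ → ℝ) :
    ∫ z, h (z ⬝ᵥ z) * ((c ⬝ᵥ z) * (d ⬝ᵥ z)) ∂(Measure.pi fun i => gaussianReal (ν i) 1) =
      (∫ x, h x ∂noncentralChiSq (Fintype.card κ + 2) (ν ⬝ᵥ ν)) * (c ⬝ᵥ d) +
      (∫ x, h x ∂noncentralChiSq (Fintype.card κ + 4) (ν ⬝ᵥ ν)) * ((c ⬝ᵥ ν) * (d ⬝ᵥ ν)) := by
  have hi := integrable_radial_mul_sq_dotProduct hh h2 h4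
  have hv := integral_radial_mul_sq_dotProduct hh h2 h4
  have : (fun z => h (z ⬝ᵥ z) * ((c ⬝ᵥ z) * (d ⬝ᵥ z))) = fun z =>
      1 / 2 * (h (z ⬝ᵥ z) * ((c + d) ⬝ᵥ z) ^ 2 - h (z ⬝ᵥ z) * (c ⬝ᵥ z) ^ 2 -
        h (z ⬝ᵥ z) * (d ⬝ᵥ z) ^ 2) := by
    ext z; rw [dotProduct_mul_dotProduct_eq c d]; ring
  rw [this, integral_const_mul, integral_sub (f := fun z => h (z ⬝ᵥ z) * ((c + d) ⬝ᵥ z) ^ 2 -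
      h (z ⬝ᵥ z) * (c ⬝ᵥ z) ^ 2) ((hi _).sub (hi _)) (hi _), integral_sub (hi _) (hi _), hv, hv, hv,
    dotProduct_mul_dotProduct_eq c d]
  simp only [add_dotProduct, dotProduct_add, dotProduct_comm d c]
  ring

lemma dotProduct_mulVec_eq_sum (M : Matrix κ κ ℝ) (z : κ → ℝ) [DecidableEq κ] :
    z ⬝ᵥ M *ᵥ z = ∑ i, (Pi.single i 1 ⬝ᵥ z) * (M.row i ⬝ᵥ z) := by
  simp only [single_one_dotProduct]
  rfl

lemma integrable_radial_mul_quadratic (hh : Measurable h)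
    (h2 : Integrable h (noncentralChiSq (Fintype.card κ + 2) (ν ⬝ᵥ ν)))
    (h4 : Integrable h (noncentralChiSq (Fintype.card κ + 4) (ν ⬝ᵥ ν))) (M : Matrix κ κ ℝ) :
    Integrable (fun z => h (z ⬝ᵥ z) * (z ⬝ᵥ M *ᵥ z))
      (Measure.pi fun i => gaussianReal (ν i) 1) := by
  classical
  simp_rw [dotProduct_mulVec_eq_sum, Finset.mul_sum]
  exact integrable_finsetSum _ fun i _ => integrable_radial_mul_dotProduct_mul hh h2 h4 _ _

lemma integral_radial_mul_quadratic (hh : Measurable h)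
    (h2 : Integrable h (noncentralChiSq (Fintype.card κ + 2) (ν ⬝ᵥ ν)))
    (h4 : Integrable h (noncentralChiSq (Fintype.card κ + 4) (ν ⬝ᵥ ν))) (M : Matrix κ κ ℝ) :
    ∫ z, h (z ⬝ᵥ z) * (z ⬝ᵥ M *ᵥ z) ∂(Measure.pi fun i => gaussianReal (ν i) 1) =
      (∫ x, h x ∂noncentralChiSq (Fintype.card κ + 2) (ν ⬝ᵥ ν)) * M.trace +
      (∫ x, h x ∂noncentralChiSq (Fintype.card κ + 4) (ν ⬝ᵥ ν)) * (ν ⬝ᵥ M *ᵥ ν) := by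
  classical
  simp_rw [dotProduct_mulVec_eq_sum, Finset.mul_sum]
  rw [integral_finsetSum _ fun i _ => integrable_radial_mul_dotProduct_mul hh h2 h4 _ _]
  simp_rw [integral_radial_mul_dotProduct_mul hh h2 h4, Finset.sum_add_distrib, Matrix.trace,
    Finset.mul_sum]
  simp

/-- Integrability of a radial function times a quadratic polynomial, with independent noise. -/
lemma integrable_radial_mul_quadratic_add_noise {κ' : Type*} [Fintype κ'] (hh : Measurable h)
    (h2 : Integrable h (noncentralChiSq (Fintype.card κ + 2) (ν ⬝ᵥ ν)))
    (h4 : Integrable h (noncentralChiSq (Fintype.card κ + 4) (ν ⬝ᵥ ν)))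
    (h0 : Integrable (fun z => h (z ⬝ᵥ z)) (Measure.pi fun i => gaussianReal (ν i) 1))
    (a : κ → ℝ) (M : Matrix κ κ ℝ) (N : Matrix κ' κ ℝ) :
    Integrable (fun x : (κ → ℝ) × (κ' → ℝ) =>
        h (x.1 ⬝ᵥ x.1) * (a ⬝ᵥ x.1 + x.1 ⬝ᵥ M *ᵥ x.1 + x.2 ⬝ᵥ N *ᵥ x.1))
      ((Measure.pi fun i => gaussianReal (ν i) 1).prod (Measure.pi fun _ => gaussianReal 0 1)) := by
  have hT : Measurable fun z : κ → ℝ => z ⬝ᵥ z := by unfold dotProduct; fun_prop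
  -- From `|u| ≤ 1 + u ^ 2`; this is the one place where `h0` enters.
  have hlin (c : κ → ℝ) : Integrable (fun z => h (z ⬝ᵥ z) * (c ⬝ᵥ z))
      (Measure.pi fun i => gaussianReal (ν i) 1) := by
    have hg : Measurable fun z : κ → ℝ => c ⬝ᵥ z := by unfold dotProduct; fun_prop
    refine (h0.norm.add (integrable_radial_mul_sq_dotProduct hh h2 h4 c).norm).mono'
      (by fun_prop) (.of_forall fun z => ?_)
    simp only [Pi.add_apply, norm_mul, norm_pow, Real.norm_eq_abs, sq_abs]
    nlinarith [abs_nonneg (h (z ⬝ᵥ z)), sq_abs (c ⬝ᵥ z), sq_nonneg (|c ⬝ᵥ z| - 1),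
      mul_nonneg (abs_nonneg (h (z ⬝ᵥ z))) (sq_nonneg (|c ⬝ᵥ z| - 1)),
      mul_nonneg (abs_nonneg (h (z ⬝ᵥ z))) (sq_nonneg (c ⬝ᵥ z))]
  have hnoise : Integrable (fun x : (κ → ℝ) × (κ' → ℝ) =>
      ∑ i, h (x.1 ⬝ᵥ x.1) * (N.row i ⬝ᵥ x.1) * x.2 i)
      ((Measure.pi fun i => gaussianReal (ν i) 1).prod (Measure.pi fun _ => gaussianReal 0 1)) :=
    integrable_finsetSum _ fun i _ =>
      (hlin (N.row i)).mul_prod (f := fun z => h (z ⬝ᵥ z) * (N.row i ⬝ᵥ z)) (g := fun w : κ' → ℝ => w i)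
        (integrable_eval IsGaussian.integrable_id)
  refine (((hlin a).add (integrable_radial_mul_quadratic hh h2 h4 M)).comp_fst _ |>.add
    hnoise).congr (.of_forall fun x => ?_)
  simp only [Pi.add_apply]
  rw [mul_add, mul_add, dotProduct_comm x.2,
    show N *ᵥ x.1 ⬝ᵥ x.2 = ∑ i, (N.row i ⬝ᵥ x.1) * x.2 i from rfl, Finset.mul_sum]
  congr 1
  exact Finset.sum_congr rfl fun i _ => mul_assoc _ _ _

lemma integral_radial_mul_quadratic_add_noise {κ' : Type*} [Fintype κ'] (hh : Measurable h)
    (h2 : Integrable h (noncentralChiSq (Fintype.card κ + 2) (ν ⬝ᵥ ν)))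
    (h4 : Integrable h (noncentralChiSq (Fintype.card κ + 4) (ν ⬝ᵥ ν)))
    (a : κ → ℝ) (M : Matrix κ κ ℝ) (N : Matrix κ' κ ℝ)
    (hi : Integrable (fun x : (κ → ℝ) × (κ' → ℝ) =>
        h (x.1 ⬝ᵥ x.1) * (a ⬝ᵥ x.1 + x.1 ⬝ᵥ M *ᵥ x.1 + x.2 ⬝ᵥ N *ᵥ x.1))
      ((Measure.pi fun i => gaussianReal (ν i) 1).prod (Measure.pi fun _ => gaussianReal 0 1))) :
    ∫ x : (κ → ℝ) × (κ' → ℝ),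
        h (x.1 ⬝ᵥ x.1) * (a ⬝ᵥ x.1 + x.1 ⬝ᵥ M *ᵥ x.1 + x.2 ⬝ᵥ N *ᵥ x.1)
      ∂((Measure.pi fun i => gaussianReal (ν i) 1).prod (Measure.pi fun _ => gaussianReal 0 1)) =
      (∫ x, h x ∂noncentralChiSq (Fintype.card κ + 2) (ν ⬝ᵥ ν)) * (a ⬝ᵥ ν + M.trace) +
      (∫ x, h x ∂noncentralChiSq (Fintype.card κ + 4) (ν ⬝ᵥ ν)) * (ν ⬝ᵥ M *ᵥ ν) := by
  have hinner (z : κ → ℝ) : ∫ w : κ' → ℝ, h (z ⬝ᵥ z) * (a ⬝ᵥ z + z ⬝ᵥ M *ᵥ z + w ⬝ᵥ N *ᵥ z)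
      ∂(Measure.pi fun _ => gaussianReal 0 1) = h (z ⬝ᵥ z) * (a ⬝ᵥ z + z ⬝ᵥ M *ᵥ z) := by
    simp_rw [dotProduct_comm _ (N *ᵥ z)]
    rw [integral_const_mul, integral_add (integrable_const _)
      ((memLp_dotProduct_pi_gaussianReal (fun _ => 0) 1 (N *ᵥ z)).integrable (by norm_num)),
      integral_dotProduct_pi_gaussianReal]
    simp [dotProduct]
  have hi' := hi.integral_prod_left
  rw [integral_prod _ hi]
  simp only [hinner] at hi' ⊢
  simp only [mul_add] at hi' ⊢
  have hq := integrable_radial_mul_quadratic hh h2 h4 M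
  -- Fubini leaves the linear plus the quadratic part integrable, and the latter is integrable by
  -- `h2` and `h4`; integrability of `h (z ⬝ᵥ z)` alone is not needed.
  have hl : Integrable (fun z => h (z ⬝ᵥ z) * (a ⬝ᵥ z))
      (Measure.pi fun i => gaussianReal (ν i) 1) := by
    refine (hi'.sub hq).congr (.of_forall fun z => ?_)
    simp
  rw [integral_add hl hq, integral_radial_mul_dotProduct hh h2 a hl,
    integral_radial_mul_quadratic hh h2 h4]
  ring

end GaussianVector

/-! ### Positive semidefinite factorizations -/

section MatrixFactorization

/-- Full-rank factorization of a positive semidefinite real matrix. -/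
lemma Matrix.PosSemidef.exists_fullRank_factorization {n : Type*} [Fintype n] [DecidableEq n]
    {S : Matrix n n ℝ} (hS : S.PosSemidef) :
    ∃ s : Set n, ∃ _ : Fintype s, ∃ (L : Matrix n s ℝ) (G : Matrix s n ℝ),
      L * Lᵀ = S ∧ G * L = 1 ∧ Fintype.card s = S.rank := by
  classical
  set U : Matrix n n ℝ := (hS.1.eigenvectorUnitary : Matrix n n ℝ) with hU
  set e := hS.1.eigenvalues with he
  have hUU : Uᵀ * U = 1 := by
    simpa [star_eq_conjTranspose] using Unitary.coe_star_mul_self hS.1.eigenvectorUnitary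
  have hspec : S = U * diagonal e * Uᵀ := by
    have := hS.1.spectral_theorem
    rw [Unitary.conjStarAlgAut_apply] at this
    simpa [star_eq_conjTranspose] using this
  have he0 (i : n) : 0 ≤ e i := hS.eigenvalues_nonneg i
  -- Orthonormal eigenvectors with nonzero eigenvalue, scaled by `√(e j)`; the inverse scaling gives
  -- a left inverse.
  refine ⟨{i | e i ≠ 0}, inferInstance, Matrix.of fun i j => U i j * √(e j),
    Matrix.of fun j i => (√(e j))⁻¹ * U i j, ?_, ?_, ?_⟩
  · ext i i'
    rw [hspec, mul_apply, mul_apply]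
    simp only [of_apply, transpose_apply, mul_diagonal]
    calc _ = ∑ j : {j | e j ≠ 0}, U i j * e j * U i' j := by
          refine Finset.sum_congr rfl fun j _ => ?_
          have := Real.mul_self_sqrt (he0 j)
          linear_combination U i j * U i' j * this
      _ = ∑ j ∈ Finset.univ.filter (fun j => e j ≠ 0), U i j * e j * U i' j :=
          (Finset.sum_subtype (p := (· ∈ {j | e j ≠ 0})) (Finset.univ.filter fun j => e j ≠ 0)
            (fun j => by simp) fun j => U i j * e j * U i' j).symm
      _ = _ := by
          refine Finset.sum_filter_of_ne fun j _ hj h0 => hj ?_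
          simp [h0]
  · ext j j'
    have := congrFun (congrFun hUU j) j'
    rw [mul_apply] at this ⊢
    simp only [transpose_apply] at this
    simp only [of_apply]
    have hj : √(e j) ≠ 0 := Real.sqrt_ne_zero'.2 (lt_of_le_of_ne (he0 j) (Ne.symm j.2))
    calc _ = (√(e j))⁻¹ * √(e j') * ∑ i, U i j * U i j' := by
          rw [Finset.mul_sum]
          exact Finset.sum_congr rfl fun i _ => by ring
      _ = _ := by
          rw [this]
          by_cases h : j = j'
          · subst h; simp [hj]
          · simp [h, Subtype.val_injective.ne h]
  · rw [hS.1.rank_eq_card_non_zero_eigs]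
    exact Fintype.card_congr (Equiv.refl _)

variable {m n : Type*} [Fintype m] [Fintype n]
  {S₁₁ A : Matrix m m ℝ} {S₁₂ : Matrix m n ℝ} {S₂₁ : Matrix n m ℝ} {S₂₂ : Matrix n n ℝ}

/-- In a Gram matrix `S₁₁ = B₁ᴴ B₁` and `S₁₂ = B₁ᴴ B₂`; `N B₁ᴴ B₁ = 0` forces `N B₁ᴴ = 0`. -/
lemma Matrix.PosSemidef.mul_fromBlocks₁₂_eq_zero (hS : (fromBlocks S₁₁ S₁₂ S₂₁ S₂₂).PosSemidef)
    {N : Matrix m m ℝ} (hN : N * S₁₁ = 0) : N * S₁₂ = 0 := by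
  classical
  obtain ⟨B, hB⟩ := CStarAlgebra.nonneg_iff_eq_star_mul_self.1 hS.nonneg
  rw [star_eq_conjTranspose, ← fromCols_toCols B, conjTranspose_fromCols_eq_fromRows_conjTranspose,
    fromRows_mul_fromCols, fromBlocks_inj] at hB
  obtain ⟨h11, h12, -, -⟩ := hB
  rw [h11] at hN
  have h0 : (N * B.toCols₁ᴴ) * (N * B.toCols₁ᴴ)ᴴ = 0 := by
    rw [conjTranspose_mul, conjTranspose_conjTranspose, ← Matrix.mul_assoc, Matrix.mul_assoc N, hN,
      Matrix.zero_mul]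
  rw [h12, ← Matrix.mul_assoc, self_mul_conjTranspose_eq_zero.1 h0, Matrix.zero_mul]

/-- This is the covariance of the residual `Y - S₂₁ A X`, a congruence of the joint covariance by
`[-S₂₁ A, 1]`. -/
lemma Matrix.PosSemidef.fromBlocks_schur_complement [DecidableEq n]
    (hS : (fromBlocks S₁₁ S₁₂ S₂₁ S₂₂).PosSemidef) (hA : A.PosSemidef)
    (hASA : A * S₁₁ * A = A) : (S₂₂ - S₂₁ * A * S₁₂).PosSemidef := by
  have h12 : S₂₁ᴴ = S₁₂ := (isHermitian_fromBlocks_iff.1 hS.1).2.2.1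
  have := hS.mul_mul_conjTranspose_same (fromCols (-(S₂₁ * A)) 1)
  convert this using 1
  rw [fromCols_mul_fromBlocks, conjTranspose_fromCols_eq_fromRows_conjTranspose,
    fromCols_mul_fromRows, conjTranspose_neg, conjTranspose_mul, h12, hA.1.eq]
  have : S₂₁ * A * S₁₁ * (A * S₁₂) = S₂₁ * A * S₁₂ := by
    calc _ = S₂₁ * (A * S₁₁ * A) * S₁₂ := by simp only [Matrix.mul_assoc]
      _ = _ := by rw [hASA]
  simp only [Matrix.neg_mul, Matrix.mul_neg, Matrix.add_mul, Matrix.one_mul, conjTranspose_one,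
    Matrix.mul_one, ← Matrix.mul_assoc]
  simp only [Matrix.mul_assoc] at this ⊢
  rw [this]
  abel

end MatrixFactorization

lemma mulVec_dotProduct_eq {m n : Type*} [Fintype m] [Fintype n] (B : Matrix m n ℝ) (x : n → ℝ)
    (y : m → ℝ) : (B *ᵥ x) ⬝ᵥ y = x ⬝ᵥ (Bᵀ *ᵥ y) := by
  rw [dotProduct_comm, dotProduct_mulVec, ← mulVec_transpose, dotProduct_comm]

/-! ### Gaussian vectors as affine images of product measures -/

section GaussianRepresentation

variable {ι τ : Type*} [Fintype ι] [DecidableEq ι] [Fintype τ]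

open Complex in
/-- A multivariate Gaussian measure is the image of a product of unit-variance Gaussian measures
under any affine map whose linear part factorizes the covariance. -/
lemma multivariateGaussian_eq_map_pi (m : ι → ℝ) (ν : τ → ℝ) (B : Matrix ι τ ℝ) :
    multivariateGaussian (WithLp.toLp 2 m) (B * Bᵀ) =
      (Measure.pi fun i => gaussianReal (ν i) 1).map
        fun x => WithLp.toLp 2 (m + B *ᵥ (x - ν)) := by
  have hB : (B * Bᵀ).PosSemidef := by
    simpa using posSemidef_self_mul_conjTranspose B
  have hmeas : Measurable fun x : τ → ℝ => WithLp.toLp 2 (m + B *ᵥ (x - ν)) :=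
    (WithLp.measurable_toLp 2 (ι → ℝ)).comp (by fun_prop)
  have : IsProbabilityMeasure ((Measure.pi fun i => gaussianReal (ν i) 1).map
        fun x => WithLp.toLp 2 (m + B *ᵥ (x - ν))) :=
    Measure.isProbabilityMeasure_map hmeas.aemeasurable
  refine Measure.ext_of_charFun (funext fun t => ?_)
  -- Moving `B` across the inner product reduces the characteristic function at `t` to that of the
  -- product measure at `Bᵀ t`, up to a phase.
  have hinner (x : τ → ℝ) : inner ℝ (WithLp.toLp 2 (m + B *ᵥ (x - ν))) t =
      (m ⬝ᵥ t.ofLp - ν ⬝ᵥ (Bᵀ *ᵥ t.ofLp)) +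
        inner ℝ (WithLp.toLp 2 x) (WithLp.toLp 2 (Bᵀ *ᵥ t.ofLp)) := by
    simp only [EuclideanSpace.inner_eq_star_dotProduct, star_trivial, dotProduct_comm _ (m + _),
      add_dotProduct, mulVec_sub, sub_dotProduct, mulVec_dotProduct_eq,
      dotProduct_comm (Bᵀ *ᵥ t.ofLp) x]
    ring
  have hpi := charFun_pi (μ := fun i => gaussianReal (ν i) 1)
    (WithLp.toLp 2 (Bᵀ *ᵥ t.ofLp) : EuclideanSpace ℝ τ)
  rw [charFun_apply, integral_map (by fun_prop) (by fun_prop)] at hpi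
  rw [charFun_multivariateGaussian hB, charFun_apply, integral_map hmeas.aemeasurable (by fun_prop)]
  simp only [hinner, ofReal_add, add_mul, Complex.exp_add]
  rw [integral_const_mul, hpi]
  simp only [charFun_gaussianReal]
  rw [← Complex.exp_sum, ← Complex.exp_add]
  congr 1
  have h1 : t.ofLp ⬝ᵥ (B * Bᵀ) *ᵥ t.ofLp = (Bᵀ *ᵥ t.ofLp) ⬝ᵥ (Bᵀ *ᵥ t.ofLp) := by
    rw [mulVec_dotProduct_eq, transpose_transpose, mulVec_mulVec]
  rw [h1, EuclideanSpace.inner_eq_star_dotProduct]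
  simp only [star_trivial, dotProduct, ofReal_sub, ofReal_sum, ofReal_mul, Finset.sum_sub_distrib,
    NNReal.coe_one, ofReal_one, one_mul, ← Finset.sum_div, ← Finset.sum_mul, pow_two]
  simp only [mul_comm (ofReal ((Bᵀ *ᵥ t.ofLp) _)) (ofReal (ν _))]
  ring

end GaussianRepresentation

section BlockGaussian

variable {ι κ κ' : Type*} [Fintype ι] [Fintype κ] [Fintype κ']

lemma measurable_blockAffine (m₁ m₂ : ι → ℝ) (ν : κ → ℝ) (L C : Matrix ι κ ℝ)
    (K : Matrix ι κ' ℝ) : Measurable fun x : (κ → ℝ) × (κ' → ℝ) =>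
      WithLp.toLp 2 (Sum.elim (m₁ + L *ᵥ (x.1 - ν)) (m₂ + C *ᵥ (x.1 - ν) + K *ᵥ x.2)) := by
  refine (WithLp.measurable_toLp 2 (ι ⊕ ι → ℝ)).comp (measurable_pi_iff.2 ?_)
  rintro (i | i)
  · simp only [Sum.elim_inl]; fun_prop
  · simp only [Sum.elim_inr]; fun_prop

/-- A Gaussian vector with two blocks, as an affine image of independent Gaussian vectors, the
first block depending on the first of them only. -/
lemma multivariateGaussian_fromBlocks_eq_map_prod [DecidableEq ι] (m₁ m₂ : ι → ℝ) (ν : κ → ℝ)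
    (L C : Matrix ι κ ℝ) (K : Matrix ι κ' ℝ) :
    multivariateGaussian (WithLp.toLp 2 (Sum.elim m₁ m₂))
        (fromBlocks (L * Lᵀ) (L * Cᵀ) (C * Lᵀ) (C * Cᵀ + K * Kᵀ)) =
      ((Measure.pi fun i => gaussianReal (ν i) 1).prod
        (Measure.pi fun _ : κ' => gaussianReal 0 1)).map fun x =>
          WithLp.toLp 2 (Sum.elim (m₁ + L *ᵥ (x.1 - ν)) (m₂ + C *ᵥ (x.1 - ν) + K *ᵥ x.2)) := by
  have hB : fromBlocks (L * Lᵀ) (L * Cᵀ) (C * Lᵀ) (C * Cᵀ + K * Kᵀ) =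
      fromBlocks L 0 C K * (fromBlocks L 0 C K)ᵀ := by
    simp [fromBlocks_transpose, fromBlocks_multiply]
  have hsum := (measurePreserving_sumPiEquivProdPi_symm
    (fun i : κ ⊕ κ' => gaussianReal ((Sum.elim ν 0 : κ ⊕ κ' → ℝ) i) 1)).map_eq
  have hmeas : Measurable fun x : κ ⊕ κ' → ℝ => WithLp.toLp 2
      (Sum.elim m₁ m₂ + fromBlocks L 0 C K *ᵥ (x - Sum.elim ν 0)) :=
    (WithLp.measurable_toLp 2 (ι ⊕ ι → ℝ)).comp (by fun_prop)
  rw [hB, multivariateGaussian_eq_map_pi _ (Sum.elim ν 0), ← hsum,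
    Measure.map_map hmeas (MeasurableEquiv.measurable _)]
  congr 1
  ext x i
  have hx : (MeasurableEquiv.sumPiEquivProdPi fun _ : κ ⊕ κ' => ℝ).symm x - Sum.elim ν 0 =
      Sum.elim (x.1 - ν) x.2 := by
    ext (j | j) <;> simp [MeasurableEquiv.coe_sumPiEquivProdPi_symm, Equiv.sumPiEquivProdPi]
  simp only [Function.comp_apply, hx, fromBlocks_mulVec]
  cases i <;> simp [Function.comp_def, add_assoc, ← Pi.sub_def]

end BlockGaussian

/-! ### Reduction to standard coordinates -/

theorem theoremA3 {Ω : Type*} [MeasurableSpace Ω] (P : Measure Ω) [IsProbabilityMeasure P]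
    (p k : ℕ) (X Y : Ω → Fin p → ℝ) (μX μY : Fin p → ℝ)
    (S11 S12 S21 S22 A W Wstar : Matrix (Fin p) (Fin p) ℝ) (h : ℝ → ℝ)
    -- `(X, Y)` is jointly Gaussian with the given mean vector and covariance matrix
    (hS : (fromBlocks S11 S12 S21 S22).PosSemidef)
    (hXY : HasLaw (fun ω => WithLp.toLp 2 (Sum.elim (X ω) (Y ω)))
      (multivariateGaussian (WithLp.toLp 2 (Sum.elim μX μY)) (fromBlocks S11 S12 S21 S22)) P)
    (hrank : S11.rank = k) (hμ : μY = -μX)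
    (hA : A.PosSemidef) (hASA : A * S11 * A = A) (hSAS : S11 * A * S11 = S11)
    (hSAμ : (S11 * A) *ᵥ μX = μX)
    (hWstar : Wstar.PosSemidef) (hW : W = CFC.sqrt A * Wstar * CFC.sqrt A)
    (hh : Measurable h)
    -- the expectations on the right-hand side exist
    (h2 : Integrable h (noncentralChiSq (k + 2) (μX ⬝ᵥ A *ᵥ μX)))
    (h4 : Integrable h (noncentralChiSq (k + 4) (μX ⬝ᵥ A *ᵥ μX))) :
    (Integrable (fun ω => h (X ω ⬝ᵥ A *ᵥ X ω)) P →
      Integrable (fun ω => h (X ω ⬝ᵥ A *ᵥ X ω) * (Y ω ⬝ᵥ W *ᵥ X ω)) P) ∧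
    (Integrable (fun ω => h (X ω ⬝ᵥ A *ᵥ X ω) * (Y ω ⬝ᵥ W *ᵥ X ω)) P →
      ∫ ω, h (X ω ⬝ᵥ A *ᵥ X ω) * (Y ω ⬝ᵥ W *ᵥ X ω) ∂P =
        - (∫ x, h x ∂noncentralChiSq (k + 2) (μX ⬝ᵥ A *ᵥ μX)) * (μX ⬝ᵥ W *ᵥ μX)
        - (∫ x, h x ∂noncentralChiSq (k + 2) (μX ⬝ᵥ A *ᵥ μX)) * (μX ⬝ᵥ (A * S12 * W) *ᵥ μX)
        + (∫ x, h x ∂noncentralChiSq (k + 2) (μX ⬝ᵥ A *ᵥ μX)) * (S12 * W * S11 * A).trace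
        + (∫ x, h x ∂noncentralChiSq (k + 4) (μX ⬝ᵥ A *ᵥ μX)) *
            (μX ⬝ᵥ (A * S12 * W) *ᵥ μX)) := by
  have hAT : Aᵀ = A := by simpa using hA.1.eq
  obtain ⟨h11, h21, h12, -⟩ := isHermitian_fromBlocks_iff.1 hS.1
  rw [conjTranspose_eq_transpose_of_trivial] at h12 h21
  -- `1 - S11 * A` annihilates `S11`, hence also the cross-covariance.
  have hSA12 : S11 * A * S12 = S12 := by
    have := hS.mul_fromBlocks₁₂_eq_zero (N := 1 - S11 * A)
      (by rw [Matrix.sub_mul, hSAS, Matrix.one_mul, sub_self])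
    rw [Matrix.sub_mul, Matrix.one_mul, sub_eq_zero] at this
    exact this.symm
  have hS11 : S11.PosSemidef := by
    simpa [submatrix] using! hS.submatrix (Sum.inl : Fin p → Fin p ⊕ Fin p)
  -- full-rank factorization of the covariance of `X`
  obtain ⟨κ, _, L, G, hLL, hGL, hcard⟩ := hS11.exists_fullRank_factorization
  have hGLT : Lᵀ * Gᵀ = 1 := by rw [← transpose_mul, hGL, transpose_one]
  have hLAL : Lᵀ * A * L = 1 := by
    calc Lᵀ * A * L = (G * L) * (Lᵀ * A * L) * (Lᵀ * Gᵀ) := by simp [hGL, hGLT]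
      _ = G * ((L * Lᵀ) * A * (L * Lᵀ)) * Gᵀ := by simp only [Matrix.mul_assoc]
      _ = G * (L * Lᵀ) * Gᵀ := by rw [hLL, hSAS]
      _ = (G * L) * (Lᵀ * Gᵀ) := by simp only [Matrix.mul_assoc]
      _ = 1 := by rw [hGL, hGLT, Matrix.one_mul]
  -- `hSAμ` places the mean in the range of `L`, even when `S11` is singular.
  obtain ⟨ν, rfl⟩ : ∃ ν, μX = L *ᵥ ν :=
    ⟨(Lᵀ * A) *ᵥ μX, by rw [mulVec_mulVec, ← Matrix.mul_assoc, hLL, hSAμ]⟩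
  have hquad (z : κ → ℝ) : L *ᵥ z ⬝ᵥ A *ᵥ (L *ᵥ z) = z ⬝ᵥ z := by
    rw [mulVec_dotProduct_eq, mulVec_mulVec, mulVec_mulVec, hLAL, one_mulVec]
  have hk : Fintype.card κ = k := hcard.trans hrank
  subst hk
  rw [hquad] at h2 h4 ⊢
  -- factorization of the joint covariance
  set C := S21 * A * L with hC
  have hCT : Cᵀ = Lᵀ * A * S12 := by
    rw [hC, transpose_mul, transpose_mul, hAT, h12, Matrix.mul_assoc]
  obtain ⟨K, hK⟩ : ∃ K : Matrix (Fin p) (Fin p) ℝ, S22 - S21 * A * S12 = K * Kᵀ := by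
    obtain ⟨B, hB⟩ := CStarAlgebra.nonneg_iff_eq_star_mul_self.1
      (hS.fromBlocks_schur_complement hA hASA).nonneg
    exact ⟨Bᵀ, by simpa [star_eq_conjTranspose] using hB⟩
  have hLC : L * Cᵀ = S12 := by
    rw [hCT, ← Matrix.mul_assoc, ← Matrix.mul_assoc, hLL, hSA12]
  have hCL : C * Lᵀ = S21 := by
    rw [← h21, ← hLC, transpose_mul, transpose_transpose]
  have hCC : C * Cᵀ + K * Kᵀ = S22 := by
    rw [← hK, hCT, ← Matrix.mul_assoc, ← Matrix.mul_assoc, hCL]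
    abel
  have hlaw := multivariateGaussian_fromBlocks_eq_map_prod (L *ᵥ ν) μY ν L C K
  rw [hLL, hLC, hCL, hCC] at hlaw
  rw [hlaw] at hXY
  set γ := (Measure.pi fun i => gaussianReal (ν i) 1).prod
    (Measure.pi fun _ : Fin p => gaussianReal 0 1) with hγ
  set Φ := fun x : (κ → ℝ) × (Fin p → ℝ) =>
    WithLp.toLp 2 (Sum.elim (L *ᵥ ν + L *ᵥ (x.1 - ν)) (μY + C *ᵥ (x.1 - ν) + K *ᵥ x.2)) with hΦ
  have hΦm : Measurable Φ := measurable_blockAffine _ _ _ _ _ _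
  -- transfer of expectations to the product space
  have hint (F : (Fin p → ℝ) → (Fin p → ℝ) → ℝ) (hF : Measurable (Function.uncurry F)) :
      (Integrable (fun ω => F (X ω) (Y ω)) P ↔
        Integrable (fun x => F (L *ᵥ x.1) (μY + C *ᵥ (x.1 - ν) + K *ᵥ x.2)) γ) ∧
      ∫ ω, F (X ω) (Y ω) ∂P =
        ∫ x, F (L *ᵥ x.1) (μY + C *ᵥ (x.1 - ν) + K *ᵥ x.2) ∂γ := by
    let F' : EuclideanSpace ℝ (Fin p ⊕ Fin p) → ℝ := fun u =>
      F (fun i => u (Sum.inl i)) (fun i => u (Sum.inr i))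
    have hF' : Measurable F' := hF.comp (f := fun u : EuclideanSpace ℝ (Fin p ⊕ Fin p) =>
      (fun i => u (Sum.inl i), fun i => u (Sum.inr i))) (by fun_prop)
    have hΦF (x : (κ → ℝ) × (Fin p → ℝ)) :
        F' (Φ x) = F (L *ᵥ x.1) (μY + C *ᵥ (x.1 - ν) + K *ᵥ x.2) := by
      simp only [F', hΦ, Sum.elim_inl, Sum.elim_inr]
      rw [← mulVec_add, add_sub_cancel]
    simp_rw [← hΦF]
    constructor
    · rw [← Function.comp_def F' Φ, ← integrable_map_measure hF'.aestronglyMeasurable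
        hΦm.aemeasurable, ← hXY.map_eq, integrable_map_measure hF'.aestronglyMeasurable
        hXY.aemeasurable]
      rfl
    · rw [← integral_map hΦm.aemeasurable hF'.aestronglyMeasurable, ← hXY.map_eq,
        integral_map hXY.aemeasurable hF'.aestronglyMeasurable]
      rfl
  have hF₁ : Measurable (Function.uncurry fun x _ : Fin p → ℝ => h (x ⬝ᵥ A *ᵥ x)) := by
    simp only [dotProduct, mulVec, Function.uncurry_def]; fun_prop
  have hF₂ : Measurable (Function.uncurry fun x y : Fin p → ℝ =>
      h (x ⬝ᵥ A *ᵥ x) * (y ⬝ᵥ W *ᵥ x)) := by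
    simp only [dotProduct, mulVec, Function.uncurry_def]; fun_prop
  -- Since `μY = -L ν`, the constant part of `Y` is `-(L ν + C ν)`, which yields the linear
  -- coefficient.
  have hpoly (x : (κ → ℝ) × (Fin p → ℝ)) :
      (μY + C *ᵥ (x.1 - ν) + K *ᵥ x.2) ⬝ᵥ W *ᵥ (L *ᵥ x.1) =
        (-((W * L)ᵀ *ᵥ (L *ᵥ ν + C *ᵥ ν))) ⬝ᵥ x.1 + x.1 ⬝ᵥ (Cᵀ * (W * L)) *ᵥ x.1 +
          x.2 ⬝ᵥ (Kᵀ * (W * L)) *ᵥ x.1 := by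
    rw [hμ, mulVec_sub, neg_dotProduct, mulVec_dotProduct_eq, transpose_transpose, mulVec_mulVec,
      ← mulVec_mulVec (M := Cᵀ), ← mulVec_mulVec (M := Kᵀ), ← mulVec_dotProduct_eq,
      ← mulVec_dotProduct_eq]
    simp only [add_dotProduct, sub_dotProduct, neg_dotProduct]
    ring
  obtain ⟨hint₁, -⟩ := hint _ hF₁
  obtain ⟨hint₂, hval⟩ := hint _ hF₂
  simp only [hquad, hpoly] at hint₁ hint₂ hval
  rw [hint₁, hint₂, hval]
  refine ⟨fun h0 => ?_, fun hi => ?_⟩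
  · have hT : Measurable fun z : κ → ℝ => h (z ⬝ᵥ z) := by unfold dotProduct; fun_prop
    exact integrable_radial_mul_quadratic_add_noise hh h2 h4
      ((measurePreserving_fst.integrable_comp hT.aestronglyMeasurable).1 h0) _ _ _
  · rw [integral_radial_mul_quadratic_add_noise hh h2 h4 _ _ _ hi]
    have htr : (Cᵀ * (W * L)).trace = (S12 * W * S11 * A).trace := by
      rw [← hLL, hCT]
      calc (Lᵀ * A * S12 * (W * L)).trace = ((Lᵀ * A) * (S12 * W * L)).trace := by
            simp only [Matrix.mul_assoc]
        _ = ((S12 * W * L) * (Lᵀ * A)).trace := trace_mul_comm _ _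
        _ = _ := by simp only [Matrix.mul_assoc]
    have hνν : ν ⬝ᵥ (Cᵀ * (W * L)) *ᵥ ν = L *ᵥ ν ⬝ᵥ (A * S12 * W) *ᵥ (L *ᵥ ν) := by
      rw [mulVec_dotProduct_eq, mulVec_mulVec, mulVec_mulVec, hCT]
      simp only [Matrix.mul_assoc]
    -- The linear term supplies both negative `k + 2` terms of the formula.
    have ha : (-((W * L)ᵀ *ᵥ (L *ᵥ ν + C *ᵥ ν))) ⬝ᵥ ν =
        -(L *ᵥ ν ⬝ᵥ W *ᵥ (L *ᵥ ν)) - L *ᵥ ν ⬝ᵥ (A * S12 * W) *ᵥ (L *ᵥ ν) := by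
      rw [← hνν, neg_dotProduct, mulVec_dotProduct_eq, transpose_transpose, add_dotProduct,
        ← mulVec_mulVec (M := Cᵀ), ← mulVec_dotProduct_eq, mulVec_mulVec]
      ring
    rw [htr, hνν, ha]
    ring
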